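/- Let $(R,\mathfrak m)$ be a Noetherian local ring, $I,J\subseteq R$ ideals, $M$ a finitely generated $R$-module and $k\ge -1$ an integer. For a finitely generated $R$-module $N$, a sequence $x_1,\dots,x_r$ of elements of $\mathfrak m$ is called an $N$-sequence in dimension $>k$ if, for each $i=1,\dots,r$, $x_i\notin\mathfrak p$ for all $\mathfrak p\in\operatorname{Ass}_R(N/(x_1,\dots,x_{i-1})N)$ with $\dim(R/\mathfrak p)>k$; such a sequence of elements of $I$ is maximal in $I$ if it cannot be prolonged to $x_1,\dots,x_r,y$ with $y\in I$. If $\dim(N/IN)>k$, let $\operatorname{depth}_k(I,N)$ be the common length of all maximal $N$-sequences in dimension $>k$ in $I$ (such sequences exist and all have the same finite length; this is part of the assertion for the modules below); if $\dim(N/IN)\le k$ (in particular if $N/IN=0$), put $\operatorname{depth}_k(I,N)=\infty$. Then: 1. there is $r_k\in\mathbb N\cup\{\infty\}$ with $\operatorname{depth}_k(I,J^nM/J^{n+1}M)=r_k$ for all large $n$; 2. there is $s_k\in\mathbb N\cup\{\infty\}$ with $\operatorname{depth}_k(I,M/J^nM)=s_k$ for all large $n$; 3. more generally than in 1, if $\mathcal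 R=\bigoplus_{n\ge0}R_n$ is a commutative graded $R$-algebra generated as an $R$-algebra by finitely many elements of degree $1$ (e.g. a standard graded algebra over $R_0=R$) and $\mathcal M=\bigoplus_{n\ge0}M_n$ is a finitely generated graded $\mathcal R$-module, then there is $t_k\in\mathbb N\cup\{\infty\}$ with $\operatorname{depth}_k(I,M_n)=t_k$ for all large $n$. -/

import Mathlib

/-- `d > k` for a Krull dimension `d` (with `⊥` the dimension of the zero module) and an integer
`k ≥ -1`: as dimensions are integers, this says `k + 1 ≤ d`, where `k + 1` is a natural number. -/
def DimGT (k : ℤ) (d : WithBot ℕ∞) : Prop :=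
  (((k + 1).toNat : ℕ) : WithBot ℕ∞) ≤ d

section

variable {R : Type*} [CommRing R] [IsLocalRing R]

/-- `x₁, …, x_r` (a list of elements of the maximal ideal) is an `M`-sequence in dimension `> k`:
`x_i ∉ 𝔭` for all `𝔭 ∈ Ass(M/(x₁, …, x_{i-1})M)` with `dim (R/𝔭) > k`.
The Lean index `i` starts at `0`, so `xs.take i` is the list of the elements before `xs[i]`. -/
def IsSeqInDim (k : ℤ) (M : Type*) [AddCommGroup M] [Module R M] (xs : List R) : Prop :=
  (∀ x ∈ xs, x ∈ IsLocalRing.maximalIdeal R) ∧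
  ∀ (i : ℕ) (hi : i < xs.length),
    ∀ p ∈ associatedPrimes R (M ⧸ (Ideal.ofList (xs.take i) • ⊤ : Submodule R M)),
      DimGT k (ringKrullDim (R ⧸ p)) → xs[i] ∉ p

/-- `xs` is a maximal `M`-sequence in dimension `> k` in the ideal `I`: it consists of elements
of `I` and cannot be prolonged by an element of `I`. -/
def IsMaxSeqInDim (k : ℤ) (I : Ideal R) (M : Type*) [AddCommGroup M] [Module R M]
    (xs : List R) : Prop :=
  (∀ x ∈ xs, x ∈ I) ∧ IsSeqInDim k M xs ∧ ∀ y ∈ I, ¬ IsSeqInDim k M (xs ++ [y])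

/-- `depth_k(I, M)` is well defined and equal to `d`. If `dim (M/IM) ≤ k` the value is `∞`.
If `dim (M/IM) > k` it is the common length of all maximal `M`-sequences in dimension `> k` in `I`
(such sequences exist, and each of them has length `d`; in particular `d` is finite). -/
def IsDepthInDim (k : ℤ) (I : Ideal R) (M : Type*) [AddCommGroup M] [Module R M] (d : ℕ∞) : Prop :=
  (¬ DimGT k (Module.supportDim R (M ⧸ (I • ⊤ : Submodule R M))) ∧ d = ⊤) ∨
  (DimGT k (Module.supportDim R (M ⧸ (I • ⊤ : Submodule R M))) ∧
    (∃ xs : List R, IsMaxSeqInDim k I M xs) ∧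
    ∀ xs : List R, IsMaxSeqInDim k I M xs → (xs.length : ℕ∞) = d)

/-- The value of `depth_k(I, M)` is unique. -/
theorem IsDepthInDim.unique {k : ℤ} {I : Ideal R} {M : Type*} [AddCommGroup M] [Module R M]
    {d e : ℕ∞} (hd : IsDepthInDim k I M d) (he : IsDepthInDim k I M e) : d = e := by
  rcases hd with ⟨h, rfl⟩ | ⟨h, ⟨xs, hxs⟩, hd⟩ <;> rcases he with ⟨h', rfl⟩ | ⟨h', -, he⟩
  · rfl
  · exact absurd h' h
  · exact absurd h h'
  · exact (hd xs hxs).symm.trans (he xs hxs)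

end

/-!
The depth of a finite module `N` in dimension `> k` is controlled by the associated primes of the
quotients `N / (xs) N`: a sequence `xs` in `I` is maximal exactly when some associated prime of
`N / (xs) N` of dimension `> k` contains `I`. So the proof has three parts.

*Maximal sequences have equal length* (`IsMaxSeqInDim.length_le`). Localized at a prime `p` of
dimension `> k`, a sequence in dimension `> k` is a weakly regular sequence. If `p` is an associated
prime of `N / (xs) N` containing `I`, a longer sequence in `I` would contradict Rees' theorem
(`IsRegularSeqModAt.length_le`). That theorem is proved here without `Ext`: prime avoidance gives an
element `z` of `I` that is regular along both sequences, `IsRegularModAt.exchange` puts it in the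
place of the last entry of `xs`, and it can be moved to the front and divided out.

*Stable associated primes imply stable depth* (`HasStableAss.exists_eventually_isDepthInDim`). If
`Ass (L n / K (L n))` is constant for large `n`, for each ideal `K`, a sequence can be built
for all large `n` at once, and it becomes maximal for all large `n` at once.

*The three families have stable associated primes.* For the components of a graded module this is
`IsComponentFamily.hasStableAss`: in large degrees nothing is annihilated by the elements of degree
`1`, so the sets of associated primes increase, inside a finite set. The powers `J ^ n M` are the
components of the Rees module, and `J ^ n M / J ^ (n + 1) M` is `J ^ n M` modulo `J`. The modules
`M / J ^ n M` are then treated by Brodmann's argument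
(`exists_associatedPrimes_quotient_pow_smul_eq`), with `M / K M` in the place of `M` for the
quotients by `K`.
-/

/-! ### Associated primes below a given prime -/

section Local

variable {R : Type*} [CommRing R] {N : Type*} [AddCommGroup N] [Module R N]

/-- If `w` is nonzero in the localization `N_p`, then some associated prime of `N` lies between
the annihilator of `w` and `p`. -/
theorem exists_mem_associatedPrimes_le [IsNoetherianRing R] (p : Ideal R) [p.IsPrime] (w : N)
    (hw : ∀ s ∉ p, s • w ≠ 0) :
    ∃ q ∈ associatedPrimes R N, (⊥ : Submodule R N).colon {w} ≤ q ∧ q ≤ p := by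
  have hle : (⊥ : Submodule R N).colon {w} ≤ p := by
    intro s hs
    by_contra hsp
    exact hw s hsp (by simpa [Submodule.mem_colon_singleton] using hs)
  obtain ⟨q, hq, hqp⟩ := Ideal.exists_minimalPrimes_le hle
  obtain ⟨y, hy⟩ := Submodule.exists_eq_colon_of_mem_minimalPrimes hq
  exact ⟨q, AssociatedPrimes.mem_iff.2 (isAssociatedPrime_iff.2 ⟨hq.isPrime, y, hy⟩), hq.1.2, hqp⟩

theorem smul_mkQ_eq_zero_iff {U : Submodule R N} {s : R} {w : N} :
    s • U.mkQ w = 0 ↔ s • w ∈ U := by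
  rw [← map_smul, Submodule.mkQ_apply, Submodule.Quotient.mk_eq_zero]

theorem mem_colon_mkQ_iff {U : Submodule R N} {s : R} {w : N} :
    s ∈ (⊥ : Submodule R (N ⧸ U)).colon {U.mkQ w} ↔ s • w ∈ U := by
  rw [Submodule.mem_colon_singleton, Submodule.mem_bot, smul_mkQ_eq_zero_iff]

/-- Prime avoidance for a finite set of primes, in contrapositive form. -/
theorem exists_mem_forall_notMem_of_finite {I : Ideal R} {Q : Set (Ideal R)} (hQ : Q.Finite)
    (hp : ∀ q ∈ Q, q.IsPrime) (h : ∀ q ∈ Q, ¬ I ≤ q) : ∃ z ∈ I, ∀ q ∈ Q, z ∉ q := by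
  have hQI : ¬ (I : Set R) ⊆ ⋃ q ∈ Q, ((id q : Ideal R) : Set R) := by
    rw [Ideal.subset_union_prime_finite hQ (f := id) ⊥ ⊥ fun q hq _ _ => hp q hq]
    rintro ⟨q, hq, hIq⟩
    exact h q hq hIq
  obtain ⟨z, hzI, hz⟩ := Set.not_subset.1 hQI
  exact ⟨z, hzI, fun q hq hzq => hz (Set.mem_biUnion hq hzq)⟩

/-! ### Regular sequences at a prime -/

/-- `z` is a nonzerodivisor on the localization `(N/U)_p`; this is expressed without localizing. -/
def IsRegularModAt (p : Ideal R) (U : Submodule R N) (z : R) : Prop :=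
  ∀ w : N, z • w ∈ U → ∃ s ∉ p, s • w ∈ U

/-- `xs` is a weakly regular sequence on the localization `(N/U)_p`. The entry following an initial
segment `l` is asked to be a nonzerodivisor modulo `U + (l)N`. -/
def IsRegularSeqModAt (p : Ideal R) (U : Submodule R N) (xs : List R) : Prop :=
  ∀ l x r, xs = l ++ x :: r → IsRegularModAt p (U ⊔ Ideal.ofList l • ⊤) x

theorem sup_ofList_cons_smul_top (U : Submodule R N) (x : R) (l : List R) :
    U ⊔ Ideal.ofList (x :: l) • (⊤ : Submodule R N) =
      (U ⊔ Ideal.span {x} • ⊤) ⊔ Ideal.ofList l • ⊤ := by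
  rw [Ideal.ofList_cons, Submodule.sup_smul, sup_assoc]

theorem sup_ofList_append_singleton_smul_top (U : Submodule R N) (x : R) (l : List R) :
    U ⊔ Ideal.ofList (l ++ [x]) • (⊤ : Submodule R N) =
      (U ⊔ Ideal.ofList l • ⊤) ⊔ Ideal.span {x} • ⊤ := by
  rw [Ideal.ofList_append, Ideal.ofList_singleton, Submodule.sup_smul, sup_assoc]

theorem mem_sup_span_singleton_smul_top {U : Submodule R N} {x : R} {w : N} :
    w ∈ U ⊔ Ideal.span {x} • (⊤ : Submodule R N) ↔ ∃ u ∈ U, ∃ v : N, w = u + x • v := by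
  simp only [Submodule.mem_sup, Submodule.ideal_span_singleton_smul]
  constructor
  · rintro ⟨u, hu, y, hy, rfl⟩
    obtain ⟨v, -, rfl⟩ := (Submodule.mem_smul_pointwise_iff_exists _ _ _).1 hy
    exact ⟨u, hu, v, rfl⟩
  · rintro ⟨u, hu, v, rfl⟩
    exact ⟨u, hu, x • v, Submodule.smul_mem_pointwise_smul _ _ _ trivial, rfl⟩

theorem isRegularSeqModAt_cons {p : Ideal R} {U : Submodule R N} {x : R} {xs : List R} :
    IsRegularSeqModAt p U (x :: xs) ↔
      IsRegularModAt p U x ∧ IsRegularSeqModAt p (U ⊔ Ideal.span {x} • ⊤) xs := by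
  constructor
  · intro h
    refine ⟨by simpa using h [] x xs rfl, fun l y r hl => ?_⟩
    rw [← sup_ofList_cons_smul_top]
    exact h (x :: l) y r (by simp [hl])
  · rintro ⟨h1, h2⟩ l y r hl
    cases l with
    | nil =>
      obtain ⟨rfl, rfl⟩ := List.cons_eq_cons.1 hl
      simpa using h1
    | cons a l =>
      obtain ⟨rfl, hl'⟩ := List.cons_eq_cons.1 hl
      rw [sup_ofList_cons_smul_top]
      exact h2 l y r hl'

theorem IsRegularSeqModAt.of_append {p : Ideal R} {U : Submodule R N} {xs ys : List R}
    (h : IsRegularSeqModAt p U (xs ++ ys)) : IsRegularSeqModAt p U xs :=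
  fun l x r hl => h l x (r ++ ys) (by simp [hl])

/-- If `x` and `z` are nonzerodivisors on `(N/U)_p` and `z` is one modulo `x`, then `x` is one
modulo `z`. -/
theorem IsRegularModAt.swap {p : Ideal R} [hp : p.IsPrime] {U : Submodule R N} {x z : R}
    (hx : IsRegularModAt p U x) (hz : IsRegularModAt p (U ⊔ Ideal.span {x} • ⊤) z) :
    IsRegularModAt p (U ⊔ Ideal.span {z} • ⊤) x := by
  intro a ha
  obtain ⟨u, hu, b, hb⟩ := mem_sup_span_singleton_smul_top.1 ha
  have hzb : z • b ∈ U ⊔ Ideal.span {x} • (⊤ : Submodule R N) :=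
    mem_sup_span_singleton_smul_top.2 ⟨-u, U.neg_mem hu, a, by rw [hb]; abel⟩
  obtain ⟨s, hs, hsb⟩ := hz b hzb
  obtain ⟨u', hu', c, hc⟩ := mem_sup_span_singleton_smul_top.1 hsb
  have key : x • (s • a - z • c) = s • u + z • u' := by
    rw [smul_sub, smul_comm x s a, hb, smul_add, smul_comm s z b, hc, smul_add, smul_comm x z c]
    abel
  obtain ⟨t, ht, hta⟩ := hx (s • a - z • c)
    (key ▸ U.add_mem (U.smul_mem _ hu) (U.smul_mem _ hu'))
  refine ⟨t * s, hp.mul_notMem ht hs, mem_sup_span_singleton_smul_top.2 ⟨_, hta, t • c, ?_⟩⟩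
  rw [smul_sub, mul_smul, smul_comm z t c]
  abel

/-- A regular sequence stays regular modulo `z` if `z` is a nonzerodivisor modulo each initial
segment of it. -/
theorem IsRegularSeqModAt.sup_span_singleton {p : Ideal R} [p.IsPrime] {z : R} {xs : List R} :
    ∀ {U : Submodule R N}, IsRegularSeqModAt p U xs →
      (∀ l, l <+: xs → IsRegularModAt p (U ⊔ Ideal.ofList l • ⊤) z) →
      IsRegularSeqModAt p (U ⊔ Ideal.span {z} • ⊤) xs := by
  induction xs with
  | nil => intro U _ _ l x r h; simp at h
  | cons x xs ih =>
    intro U h hz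
    rw [isRegularSeqModAt_cons] at h ⊢
    refine ⟨h.1.swap ?_, ?_⟩
    · simpa using hz [x] (by simp)
    · rw [sup_right_comm]
      refine ih h.2 fun l hl => ?_
      rw [← sup_ofList_cons_smul_top]
      exact hz (x :: l) (by simpa using hl)

/-- Exchange of nonzerodivisors `x, z ∈ I` on `(N/U)_p`: if `I` annihilates an element of
`N/(U + xN)` that is nonzero at `p`, it annihilates such an element of `N/(U + zN)`. Both say that
`Ext¹(R/I, N/U)` is nonzero at `p`. If `I u ⊆ U + xN`, the new element is a multiple by some
`s ∉ p` of the `w` with `z u ≡ x w` modulo `U`. -/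
theorem IsRegularModAt.exchange {p : Ideal R} [hp : p.IsPrime] {I : Ideal R} (hI : I.FG)
    {U : Submodule R N} {x z : R} (hzI : z ∈ I) (hx : IsRegularModAt p U x)
    (hz : IsRegularModAt p U z) {u : N}
    (hu : ∀ a ∈ I, a • u ∈ U ⊔ Ideal.span {x} • (⊤ : Submodule R N))
    (hu' : ∀ s ∉ p, s • u ∉ U ⊔ Ideal.span {x} • (⊤ : Submodule R N)) :
    ∃ w : N, (∀ a ∈ I, a • w ∈ U ⊔ Ideal.span {z} • (⊤ : Submodule R N)) ∧
      ∀ s ∉ p, s • w ∉ U ⊔ Ideal.span {z} • (⊤ : Submodule R N) := by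
  obtain ⟨u₀, hu₀, w, hw⟩ := mem_sup_span_singleton_smul_top.1 (hu z hzI)
  have h1 : ∀ a ∈ I, ∃ s ∉ p, s • a • w ∈ U ⊔ Ideal.span {z} • (⊤ : Submodule R N) := by
    intro a ha
    obtain ⟨u₁, hu₁, v, hv⟩ := mem_sup_span_singleton_smul_top.1 (hu a ha)
    have key : x • (a • w - z • v) = z • u₁ - a • u₀ := by
      have e1 : x • a • w = a • z • u - a • u₀ := by rw [hw, smul_add, smul_comm x a w]; abel
      have e2 : x • z • v = z • a • u - z • u₁ := by rw [hv, smul_add, smul_comm x z v]; abel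
      rw [smul_sub, e1, e2, smul_comm a z u]
      abel
    obtain ⟨s, hs, hsv⟩ := hx _ (key ▸ U.sub_mem (U.smul_mem _ hu₁) (U.smul_mem _ hu₀))
    refine ⟨s, hs, mem_sup_span_singleton_smul_top.2 ⟨_, hsv, s • v, ?_⟩⟩
    rw [smul_sub, smul_comm z s v]
    abel
  -- A common multiplier exists as `I` is finitely generated.
  obtain ⟨s, hs, hsI⟩ : ∃ s ∉ p, ∀ a ∈ I, a • s • w ∈ U ⊔ Ideal.span {z} • (⊤ : Submodule R N) := by
    obtain ⟨G, rfl⟩ := hI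
    choose! f hf hfw using h1
    refine ⟨∏ g ∈ G, f g, fun h => ?_, fun a ha => ?_⟩
    · obtain ⟨g, hg, hgp⟩ := (hp.prod_mem_iff).1 h
      exact hf g (Ideal.subset_span hg) hgp
    · suffices Ideal.span (G : Set R) ≤ (U ⊔ Ideal.span {z} • (⊤ : Submodule R N)).colon
          {(∏ g ∈ G, f g) • w} from Submodule.mem_colon_singleton.1 (this ha)
      refine Ideal.span_le.2 fun g hg => Submodule.mem_colon_singleton.2 ?_
      obtain ⟨c, hc⟩ := Finset.dvd_prod_of_mem f hg
      rw [hc, smul_smul, show g * (f g * c) = c * (f g * g) by ring, mul_smul, mul_smul]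
      exact Submodule.smul_mem _ _ (hfw g (Ideal.subset_span hg))
  refine ⟨s • w, hsI, fun t ht htw => ?_⟩
  obtain ⟨u₁, hu₁, v, hv⟩ := mem_sup_span_singleton_smul_top.1 htw
  have key : z • ((t * s) • u - x • v) = (t * s) • u₀ + x • u₁ := by
    have e : x • z • v = x • t • s • w - x • u₁ := by rw [hv, smul_add]; abel
    rw [smul_sub, smul_comm z x v, e, smul_comm z (t * s) u, hw, smul_add, smul_smul t s w,
      smul_comm (t * s) x w]
    abel
  obtain ⟨r, hr, hru⟩ := hz _ (key ▸ U.add_mem (U.smul_mem _ hu₀) (U.smul_mem _ hu₁))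
  refine hu' (r * (t * s)) (hp.mul_notMem hr (hp.mul_notMem ht hs))
    (mem_sup_span_singleton_smul_top.2 ⟨_, hru, r • v, ?_⟩)
  rw [smul_sub, mul_smul, smul_comm x r v]
  abel

/-- An element outside the associated primes of `N/U` contained in `p` is a nonzerodivisor on
`(N/U)_p`. -/
theorem isRegularModAt_of_notMem [IsNoetherianRing R] {p : Ideal R} [p.IsPrime]
    {U : Submodule R N} {z : R} (h : ∀ q ∈ associatedPrimes R (N ⧸ U), q ≤ p → z ∉ q) :
    IsRegularModAt p U z := by
  intro w hw
  by_contra! hs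
  obtain ⟨q, hq, hwq, hqp⟩ := exists_mem_associatedPrimes_le p (U.mkQ w) fun s hsp => by
    rw [Ne, smul_mkQ_eq_zero_iff]
    exact hs s hsp
  exact h q hq hqp (hwq (mem_colon_mkQ_iff.2 hw))

theorem IsRegularModAt.notMem [IsNoetherianRing R] {p : Ideal R}
    {U : Submodule R N} {z : R} (h : IsRegularModAt p U z) {q : Ideal R}
    (hq : q ∈ associatedPrimes R (N ⧸ U)) (hqp : q ≤ p) : z ∉ q := by
  intro hz
  obtain ⟨-, y, rfl⟩ := isAssociatedPrime_iff.1 hq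
  obtain ⟨w, rfl⟩ := U.mkQ_surjective y
  obtain ⟨s, hs, hsw⟩ := h w (mem_colon_mkQ_iff.1 hz)
  exact hs (hqp (mem_colon_mkQ_iff.2 hsw))

/-- Prime avoidance: if `I` contains a nonzerodivisor on each of finitely many modules `(N/U)_p`,
it contains a common one. -/
theorem exists_forall_isRegularModAt [IsNoetherianRing R] [Module.Finite R N] {p : Ideal R}
    [p.IsPrime] {I : Ideal R} {𝒰 : Set (Submodule R N)} (h𝒰 : 𝒰.Finite)
    (h : ∀ U ∈ 𝒰, ∃ z ∈ I, IsRegularModAt p U z) : ∃ z ∈ I, ∀ U ∈ 𝒰, IsRegularModAt p U z := by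
  let Q : Set (Ideal R) := ⋃ U ∈ 𝒰, {q ∈ associatedPrimes R (N ⧸ U) | q ≤ p}
  have hQ : Q.Finite := h𝒰.biUnion fun U _ => (associatedPrimes.finite R (N ⧸ U)).subset (by simp)
  have hmem : ∀ q, q ∈ Q ↔ ∃ U ∈ 𝒰, q ∈ associatedPrimes R (N ⧸ U) ∧ q ≤ p := by
    intro q
    simp only [Q, Set.mem_iUnion₂, Set.mem_ofPred_eq, exists_prop]
  obtain ⟨z, hzI, hz⟩ := exists_mem_forall_notMem_of_finite hQ (I := I)
    (fun q hq => by
      obtain ⟨U, -, hq, -⟩ := (hmem q).1 hq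
      exact hq.1)
    (fun q hq hIq => by
      obtain ⟨U, hU, hq, hqp⟩ := (hmem q).1 hq
      obtain ⟨z, hz, hzU⟩ := h U hU
      exact hzU.notMem hq hqp (hIq hz))
  exact ⟨z, hzI, fun U hU => isRegularModAt_of_notMem fun q hq hqp =>
    hz q ((hmem q).2 ⟨U, hU, hq, hqp⟩)⟩

/-- Rees: if `xs` is a regular sequence in `I` on `(N/U)_p` and `I` annihilates an element of
`N/(U + (xs)N)` that is nonzero at `p`, then no regular sequence in `I` is longer than `xs`.
The last entry of `xs` is replaced by an element `z` that is regular along both sequences, and then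
`N` by `N/zN`. -/
theorem IsRegularSeqModAt.length_le [IsNoetherianRing R] [Module.Finite R N] {p : Ideal R}
    [p.IsPrime] {I : Ideal R} {xs : List R} :
    ∀ {U : Submodule R N} {ys : List R}, IsRegularSeqModAt p U xs → IsRegularSeqModAt p U ys →
      (∀ x ∈ xs, x ∈ I) → (∀ y ∈ ys, y ∈ I) →
      (∃ u : N, (∀ a ∈ I, a • u ∈ U ⊔ Ideal.ofList xs • (⊤ : Submodule R N)) ∧
        ∀ s ∉ p, s • u ∉ U ⊔ Ideal.ofList xs • (⊤ : Submodule R N)) →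
      ys.length ≤ xs.length := by
  induction xs using List.reverseRecOn with
  | nil =>
    rintro U ys - hys - hyI ⟨u, hu, hu'⟩
    cases ys with
    | nil => rfl
    | cons y ys =>
      obtain ⟨s, hs, hsu⟩ := (isRegularSeqModAt_cons.1 hys).1 u
        (by simpa using hu y (hyI y (by simp)))
      exact absurd (by simpa using hsu) (hu' s hs)
  | append_singleton xs x ih =>
    rintro U ys hxs hys hxI hyI ⟨u, hu, hu'⟩
    rcases List.eq_nil_or_concat' ys with rfl | ⟨ys, y, rfl⟩
    · simp
    obtain ⟨z, hzI, hz⟩ := exists_forall_isRegularModAt (p := p) (I := I)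
      (𝒰 := (fun l => U ⊔ Ideal.ofList l • (⊤ : Submodule R N)) '' {l | l <+: xs ∨ l <+: ys})
      (Set.Finite.image _ <| (xs.inits ++ ys.inits).finite_toSet.subset fun l hl => by
        simpa using hl) <| by
      -- The entry of the sequence that follows the initial segment `l` is regular there.
      have aux : ∀ (zs : List R) (a : R), IsRegularSeqModAt p U (zs ++ [a]) →
          (∀ b ∈ zs ++ [a], b ∈ I) → ∀ l, l <+: zs →
          ∃ z ∈ I, IsRegularModAt p (U ⊔ Ideal.ofList l • (⊤ : Submodule R N)) z := by
        rintro zs a hzs hzI l ⟨r, rfl⟩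
        obtain ⟨b, r', hr⟩ : ∃ b r', r ++ [a] = b :: r' := by cases r <;> simp
        refine ⟨b, hzI b (by simp [List.append_assoc, hr]), hzs l b r' ?_⟩
        rw [List.append_assoc, hr]
      rintro _ ⟨l, hl | hl, rfl⟩
      exacts [aux xs x hxs hxI l hl, aux ys y hys hyI l hl]
    replace hz : ∀ l, l <+: xs ∨ l <+: ys →
        IsRegularModAt p (U ⊔ Ideal.ofList l • (⊤ : Submodule R N)) z :=
      fun l hl => hz _ ⟨l, hl, rfl⟩
    rw [sup_ofList_append_singleton_smul_top] at hu hu'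
    obtain ⟨w, hw, hw'⟩ := (hxs xs x [] rfl).exchange (IsNoetherian.noetherian I) hzI
      (hz xs (Or.inl List.prefix_rfl)) hu hu'
    have := ih (hxs.of_append.sup_span_singleton fun l hl => hz l (Or.inl hl))
      (hys.of_append.sup_span_singleton fun l hl => hz l (Or.inr hl))
      (fun a ha => hxI a (by simp [ha])) (fun a ha => hyI a (by simp [ha]))
      ⟨w, by simpa only [sup_right_comm] using hw, by simpa only [sup_right_comm] using hw'⟩
    simpa using this

end Local

/-! ### Dimension and associated primes -/

section Dimension

variable {R : Type*} [CommRing R]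

theorem DimGT.quotient_of_le {k : ℤ} {p q : Ideal R} (hqp : q ≤ p)
    (h : DimGT k (ringKrullDim (R ⧸ p))) : DimGT k (ringKrullDim (R ⧸ q)) :=
  le_trans h (ringKrullDim_le_of_surjective (Ideal.Quotient.factor hqp)
    (Ideal.Quotient.factor_surjective hqp))

/-- The dimension of a module exceeds `k` if and only if one of its associated primes has
dimension `> k`, since each prime of the support contains an associated prime. -/
theorem dimGT_supportDim_iff [IsNoetherianRing R] {k : ℤ} {N : Type*} [AddCommGroup N]
    [Module R N] : DimGT k (Module.supportDim R N) ↔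
      ∃ q ∈ associatedPrimes R N, DimGT k (ringKrullDim (R ⧸ q)) := by
  constructor
  · intro h
    obtain ⟨l, hl⟩ := Order.le_krullDim_iff.1 h
    obtain ⟨m, hm⟩ := Module.mem_support_iff'.1 l.head.2
    obtain ⟨q, hq, -, hqp⟩ := exists_mem_associatedPrimes_le l.head.1.asIdeal m hm
    refine ⟨q, hq, ?_⟩
    rw [ringKrullDim_quotient]
    refine Order.le_krullDim_iff.2
      ⟨⟨l.length, fun i => ⟨(l i).1, hqp.trans (l.head_le i)⟩, fun i => l.step i⟩, hl⟩
  · rintro ⟨q, hq, h⟩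
    refine le_trans h ?_
    rw [ringKrullDim_quotient]
    obtain ⟨-, y, rfl⟩ := isAssociatedPrime_iff.1 hq
    refine Order.krullDim_le_of_strictMono
      (fun P => ⟨P.1, Module.mem_support_iff'.2 ⟨y, fun r hr hry => hr (P.2 ?_)⟩⟩) fun _ _ h => h
    simpa [Submodule.mem_colon_singleton] using hry

theorem exists_mem_associatedPrimes_dimGT_of_le [IsNoetherianRing R] {k : ℤ} {N : Type*}
    [AddCommGroup N] [Module R N] {K I : Ideal R} (hKI : K ≤ I)
    (h : DimGT k (Module.supportDim R (N ⧸ (I • ⊤ : Submodule R N)))) :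
    ∃ q ∈ associatedPrimes R (N ⧸ (K • ⊤ : Submodule R N)), DimGT k (ringKrullDim (R ⧸ q)) :=
  dimGT_supportDim_iff.1 <| le_trans h <| Module.supportDim_le_of_surjective
    (Submodule.factor (Submodule.smul_mono_left hKI)) (Submodule.factor_surjective _)

end Dimension

/-! ### Sequences in dimension `> k` -/

section Depth

variable {R : Type*} [CommRing R] [IsLocalRing R]

section

variable {k : ℤ} {I : Ideal R} {N : Type*} [AddCommGroup N] [Module R N]

theorem isSeqInDim_nil : IsSeqInDim k N ([] : List R) := by
  simp [IsSeqInDim]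

theorem isSeqInDim_append_singleton {xs : List R} {y : R} :
    IsSeqInDim k N (xs ++ [y]) ↔ IsSeqInDim k N xs ∧ y ∈ IsLocalRing.maximalIdeal R ∧
      ∀ p ∈ associatedPrimes R (N ⧸ (Ideal.ofList xs • ⊤ : Submodule R N)),
        DimGT k (ringKrullDim (R ⧸ p)) → y ∉ p := by
  constructor
  · rintro ⟨h1, h2⟩
    refine ⟨⟨fun x hx => h1 x (by simp [hx]), fun i hi => ?_⟩, h1 y (by simp), ?_⟩
    · have := h2 i (by simp; lia)
      rwa [List.take_append_of_le_length hi.le, List.getElem_append_left hi] at this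
    · have := h2 xs.length (by simp)
      rwa [List.take_left, List.getElem_concat_length rfl] at this
  · rintro ⟨⟨h1, h2⟩, hy, h3⟩
    refine ⟨fun x hx => ?_, fun i hi => ?_⟩
    · rcases List.mem_append.1 hx with hx | hx
      · exact h1 x hx
      · rwa [List.mem_singleton.1 hx]
    · rcases lt_or_ge i xs.length with hi' | hi'
      · rw [List.take_append_of_le_length hi'.le, List.getElem_append_left hi']
        exact h2 i hi'
      · obtain rfl : i = xs.length := by simp at hi; lia
        rwa [List.take_left, List.getElem_concat_length rfl]

/-- A sequence in dimension `> k` is a regular sequence at each prime of dimension `> k`. -/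
theorem IsSeqInDim.isRegularSeqModAt [IsNoetherianRing R] {xs : List R} (h : IsSeqInDim k N xs)
    {p : Ideal R} [p.IsPrime] (hp : DimGT k (ringKrullDim (R ⧸ p))) :
    IsRegularSeqModAt p (⊥ : Submodule R N) xs := by
  rintro l x r rfl
  rw [bot_sup_eq]
  refine isRegularModAt_of_notMem fun q hq hqp => ?_
  have := h.2 l.length (by simp)
  rw [List.take_left] at this
  simpa using this q hq (hp.quotient_of_le hqp)

theorem IsSeqInDim.isMaxSeqInDim {xs : List R} (h : IsSeqInDim k N xs) (hI : ∀ x ∈ xs, x ∈ I)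
    {q : Ideal R} (hq : q ∈ associatedPrimes R (N ⧸ (Ideal.ofList xs • ⊤ : Submodule R N)))
    (hqk : DimGT k (ringKrullDim (R ⧸ q))) (hIq : I ≤ q) : IsMaxSeqInDim k I N xs :=
  ⟨hI, h, fun _ hy h' => (isSeqInDim_append_singleton.1 h').2.2 q hq hqk (hIq hy)⟩

theorem IsMaxSeqInDim.exists_le [IsNoetherianRing R] [Module.Finite R N] {xs : List R}
    (h : IsMaxSeqInDim k I N xs) (hI : I ≤ IsLocalRing.maximalIdeal R) :
    ∃ q ∈ associatedPrimes R (N ⧸ (Ideal.ofList xs • ⊤ : Submodule R N)),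
      DimGT k (ringKrullDim (R ⧸ q)) ∧ I ≤ q := by
  by_contra! hc
  obtain ⟨y, hyI, hy⟩ := exists_mem_forall_notMem_of_finite (I := I)
    (Q := {q ∈ associatedPrimes R (N ⧸ (Ideal.ofList xs • ⊤ : Submodule R N)) |
      DimGT k (ringKrullDim (R ⧸ q))})
    ((associatedPrimes.finite R _).subset (Set.sep_subset _ _)) (fun q hq => hq.1.1)
    fun q hq => hc q hq.1 hq.2
  exact h.2.2 y hyI (isSeqInDim_append_singleton.2
    ⟨h.2.1, hI hyI, fun q hq hqk => hy q ⟨hq, hqk⟩⟩)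

/-- No sequence in dimension `> k` in `I` is longer than a maximal one: localize at an associated
prime of `N/(xs)N` that contains `I`. -/
theorem IsMaxSeqInDim.length_le [IsNoetherianRing R] [Module.Finite R N] {xs ys : List R}
    (h : IsMaxSeqInDim k I N xs) (hI : I ≤ IsLocalRing.maximalIdeal R) (hys : IsSeqInDim k N ys)
    (hysI : ∀ y ∈ ys, y ∈ I) : ys.length ≤ xs.length := by
  obtain ⟨q, hq, hqk, hIq⟩ := h.exists_le hI
  have := hq.1
  obtain ⟨-, u, hu⟩ := isAssociatedPrime_iff.1 hq
  obtain ⟨u, rfl⟩ := Submodule.mkQ_surjective _ u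
  refine (h.2.1.isRegularSeqModAt hqk).length_le (hys.isRegularSeqModAt hqk) h.1 hysI ⟨u, ?_, ?_⟩
  · intro a ha
    rw [bot_sup_eq, ← mem_colon_mkQ_iff, ← hu]
    exact hIq ha
  · intro s hs
    rwa [bot_sup_eq, ← mem_colon_mkQ_iff, ← hu]

theorem le_maximalIdeal_of_dimGT_supportDim [IsNoetherianRing R]
    (hd : DimGT k (Module.supportDim R (N ⧸ (I • ⊤ : Submodule R N)))) :
    I ≤ IsLocalRing.maximalIdeal R := by
  refine IsLocalRing.le_maximalIdeal ?_
  rintro rfl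
  obtain ⟨q, hq, -⟩ := dimGT_supportDim_iff.1 hd
  have : Subsingleton (N ⧸ ((⊤ : Ideal R) • ⊤ : Submodule R N)) :=
    Submodule.Quotient.subsingleton_iff.2 (by simp)
  exact not_isAssociatedPrime_of_subsingleton hq

theorem IsMaxSeqInDim.isDepthInDim [IsNoetherianRing R] [Module.Finite R N] {xs : List R}
    (h : IsMaxSeqInDim k I N xs)
    (hd : DimGT k (Module.supportDim R (N ⧸ (I • ⊤ : Submodule R N)))) :
    IsDepthInDim k I N xs.length := by
  have hI := le_maximalIdeal_of_dimGT_supportDim hd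
  refine Or.inr ⟨hd, ⟨xs, h⟩, fun ys hys => ?_⟩
  exact_mod_cast le_antisymm (h.length_le hI hys.2.1 hys.1) (hys.length_le hI h.2.1 h.1)

end

/-! ### Families of modules with stable associated primes -/

/-- `Ass (L n / K (L n))` does not depend on `n` for large `n`, for each ideal `K`. -/
def HasStableAss (L : ℕ → Type*) [∀ n, AddCommGroup (L n)] [∀ n, Module R (L n)] : Prop :=
  ∀ K : Ideal R, ∃ A : Set (Ideal R), ∀ᶠ n in Filter.atTop,
    associatedPrimes R (L n ⧸ (K • ⊤ : Submodule R (L n))) = A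

/-- The depth in dimension `> k` is eventually constant along a family whose quotients by ideals
have stable associated primes. By prime avoidance the next entry of a sequence can be chosen for
all large `n` at once, and the ideals generated by the sequences so obtained increase strictly. -/
theorem HasStableAss.exists_eventually_isDepthInDim [IsNoetherianRing R] {L : ℕ → Type*}
    [∀ n, AddCommGroup (L n)] [∀ n, Module R (L n)] [∀ n, Module.Finite R (L n)]
    (hL : HasStableAss (R := R) L) (k : ℤ) (I : Ideal R) :
    ∃ r : ℕ∞, ∀ᶠ n in Filter.atTop, IsDepthInDim k I (L n) r := by
  choose A hA using hL
  have hdim : ∀ᶠ n in Filter.atTop,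
      (DimGT k (Module.supportDim R (L n ⧸ (I • ⊤ : Submodule R (L n)))) ↔
        ∃ q ∈ A I, DimGT k (ringKrullDim (R ⧸ q))) := by
    filter_upwards [hA I] with n hn
    rw [dimGT_supportDim_iff, hn]
  by_cases hAI : ∃ q ∈ A I, DimGT k (ringKrullDim (R ⧸ q))
  swap
  · exact ⟨⊤, hdim.mono fun n hn => Or.inl ⟨mt hn.1 hAI, rfl⟩⟩
  replace hdim := hdim.mono fun n hn => hn.2 hAI
  have hI : I ≤ IsLocalRing.maximalIdeal R := by
    obtain ⟨n, hn⟩ := hdim.exists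
    exact le_maximalIdeal_of_dimGT_supportDim hn
  -- Among the ideals `(xs)` with `xs` in `I` a sequence for all large `n`, take a maximal one.
  obtain ⟨_, ⟨xs, rfl, hxsI, hxs⟩, hmax⟩ := set_has_maximal_iff_noetherian.2
    (inferInstanceAs (IsNoetherian R R))
    {K : Ideal R | ∃ xs : List R, Ideal.ofList xs = K ∧ (∀ x ∈ xs, x ∈ I) ∧
      ∀ᶠ n in Filter.atTop, IsSeqInDim k (L n) xs}
    ⟨_, [], rfl, by simp, Filter.Eventually.of_forall fun _ => isSeqInDim_nil⟩
  obtain ⟨q, hq, hqk, hIq⟩ : ∃ q ∈ A (Ideal.ofList xs), DimGT k (ringKrullDim (R ⧸ q)) ∧ I ≤ q := by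
    by_contra! hc
    obtain ⟨n, hnA, hnd⟩ := ((hA (Ideal.ofList xs)).and hdim).exists
    obtain ⟨y, hyI, hy⟩ := exists_mem_forall_notMem_of_finite (I := I)
      (Q := {q ∈ A (Ideal.ofList xs) | DimGT k (ringKrullDim (R ⧸ q))})
      ((hnA ▸ associatedPrimes.finite R _).subset (Set.sep_subset _ _))
      (fun q hq => (hnA ▸ hq.1 : q ∈ associatedPrimes R _).1) fun q hq => hc q hq.1 hq.2
    -- The element `y` is new: `(xs)` lies in each associated prime of `L n / (xs) (L n)`.
    have hyxs : y ∉ Ideal.ofList xs := by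
      intro hyxs
      obtain ⟨q, hq, hqk⟩ := exists_mem_associatedPrimes_dimGT_of_le
        (Ideal.span_le.2 hxsI : Ideal.ofList xs ≤ I) hnd
      refine hy q ⟨hnA ▸ hq, hqk⟩ ?_
      obtain ⟨-, u, rfl⟩ := isAssociatedPrime_iff.1 hq
      obtain ⟨u, rfl⟩ := Submodule.mkQ_surjective _ u
      exact mem_colon_mkQ_iff.2 (Submodule.smul_mem_smul hyxs trivial)
    refine hmax (Ideal.ofList (xs ++ [y])) ⟨xs ++ [y], rfl, ?_, ?_⟩ ?_
    · intro x hx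
      rcases List.mem_append.1 hx with hx | hx
      · exact hxsI x hx
      · rwa [List.mem_singleton.1 hx]
    · filter_upwards [hxs, hA (Ideal.ofList xs)] with n h1 h2
      exact isSeqInDim_append_singleton.2
        ⟨h1, hI hyI, fun q hq hqk => hy q ⟨h2 ▸ hq, hqk⟩⟩
    · rw [Ideal.ofList_append, Ideal.ofList_singleton]
      refine left_lt_sup.2 fun h => hyxs (h (Ideal.mem_span_singleton_self y))
  refine ⟨xs.length, ?_⟩
  filter_upwards [hxs, hA (Ideal.ofList xs), hdim] with n h1 h2 h3
  exact (h1.isMaxSeqInDim hxsI (h2 ▸ hq) hqk hIq).isDepthInDim h3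

end Depth

/-! ### Associated primes of the components of a graded module -/

section Graded

variable {R S : Type*} [CommRing R] [CommRing S] [Algebra R S]

/-- The associated primes over `R` of a finite module over a Noetherian `R`-algebra `S` are
finite in number: in a filtration with factors `S/P` each factor contributes only `P ∩ R`. -/
theorem associatedPrimes_finite_of_finite_algebra [IsNoetherianRing R] [IsNoetherianRing S]
    (N : Type*) [AddCommGroup N] [Module S N] [Module R N] [IsScalarTower R S N]
    [Module.Finite S N] : (associatedPrimes R N).Finite := by
  -- The `R`-module structure is expressed through `S`, so that the induction can run over
  -- `S`-modules alone.
  suffices H : {p : Ideal R | p.IsPrime ∧ ∃ x : N,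
      ∀ r, r ∈ p ↔ algebraMap R S r • x = 0}.Finite by
    refine H.subset fun p hp => ?_
    obtain ⟨hp, x, rfl⟩ := isAssociatedPrime_iff.1 hp
    exact ⟨hp, x, fun r => by simp [Submodule.mem_colon_singleton]⟩
  rename_i _ _ _ _ hfin
  induction hfin using IsNoetherianRing.induction_on_isQuotientEquivQuotientPrime S with
  | subsingleton N =>
    refine Set.finite_empty.subset ?_
    rintro p ⟨hp, x, hx⟩
    exact hp.one_notMem ((hx 1).2 (Subsingleton.elim _ _))
  | quotient N P e =>
    refine (Set.finite_singleton (P.1.comap (algebraMap R S))).subset ?_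
    rintro p ⟨hp, x, hx⟩
    have hx0 : x ≠ 0 := fun h => hp.one_notMem ((hx 1).2 (by simp [h]))
    ext r
    rw [hx, ← map_eq_zero_iff e e.injective, map_smul]
    have : e x ≠ 0 := by simpa
    rw [Algebra.smul_def, mul_eq_zero, or_iff_left this]
    exact Ideal.Quotient.eq_zero_iff_mem
  | exact N₁ N₂ N₃ f g hf hg hfg h₁ h₃ =>
    refine (h₁.union h₃).subset ?_
    rintro p ⟨hp, x, hx⟩
    by_cases h : ∃ a ∉ p, ∃ y, f y = algebraMap R S a • x
    · obtain ⟨a, ha, y, hy⟩ := h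
      refine Or.inl ⟨hp, y, fun r => ?_⟩
      rw [← map_eq_zero_iff f hf, map_smul, hy, smul_smul, ← map_mul, ← hx]
      exact ⟨fun h => p.mul_mem_right _ h, fun h => (hp.mem_or_mem h).resolve_right ha⟩
    · push Not at h
      refine Or.inr ⟨hp, g x, fun r => ⟨fun hr => ?_, fun hr => ?_⟩⟩
      · rw [← map_smul, (hx r).1 hr, map_zero]
      · by_contra hrp
        rw [← map_smul] at hr
        obtain ⟨y, hy⟩ := (hfg _).1 hr
        exact h r hrp y hy

/-- If `T` generates `S` as an `R`-algebra, an `R`-submodule stable under `T` is stable under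
`S`. -/
theorem smul_mem_of_adjoin_eq_top {N : Type*} [AddCommGroup N] [Module S N] [Module R N]
    [IsScalarTower R S N] {T : Set S} (hT : Algebra.adjoin R T = ⊤) {W : Submodule R N}
    (hW : ∀ t ∈ T, ∀ w ∈ W, t • w ∈ W) (s : S) {w : N} (hw : w ∈ W) : s • w ∈ W := by
  have hs : s ∈ Algebra.adjoin R T := hT ▸ Algebra.mem_top
  induction hs using Algebra.adjoin_induction generalizing w with
  | mem t ht => exact hW t ht w hw
  | algebraMap r => rw [algebraMap_smul]; exact W.smul_mem r hw
  | add a b _ _ ha hb => rw [add_smul]; exact W.add_mem (ha hw) (hb hw)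
  | mul a b _ _ ha hb => rw [mul_smul]; exact ha (hb hw)

/-- If `T` generates `S` as an `R`-algebra and annihilates a finite `S`-module, then this module
is finite over `R`. -/
theorem finite_of_smul_eq_zero {N : Type*} [AddCommGroup N] [Module S N] [Module R N]
    [IsScalarTower R S N] [Module.Finite S N] {T : Set S} (hT : Algebra.adjoin R T = ⊤)
    (h0 : ∀ t ∈ T, ∀ w : N, t • w = 0) : Module.Finite R N := by
  obtain ⟨G, hG⟩ := Module.Finite.fg_top (R := S) (M := N)
  refine ⟨G, eq_top_iff.2 fun w _ => ?_⟩
  have hw : w ∈ Submodule.span S (G : Set N) := hG ▸ trivial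
  induction hw using Submodule.span_induction with
  | mem x hx => exact Submodule.subset_span hx
  | zero => exact zero_mem _
  | add x y _ _ hx hy => exact add_mem (hx trivial) (hy trivial)
  | smul s x _ hx =>
    exact smul_mem_of_adjoin_eq_top hT (fun t ht v _ => by rw [h0 t ht]; exact zero_mem _) s
      (hx trivial)

/-- The family `L` consists of the components of an `S`-module `N` on which the elements of `T`
act with degree `1`. The components are given by inclusions `ι n : L n → N` and projections
`π n : N → L n`; this data passes to the quotients `L n / K (L n)` and `N / K N`. The sum of the
components need not be all of `N`. -/
structure IsComponentFamily (T : Set S) (N : Type*) [AddCommGroup N] [Module S N] [Module R N]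
    (L : ℕ → Type*) [∀ n, AddCommGroup (L n)] [∀ n, Module R (L n)]
    (ι : ∀ n, L n →ₗ[R] N) (π : ∀ n, N →ₗ[R] L n) : Prop where
  proj_self : ∀ n z, π n (ι n z) = z
  proj_of_ne : ∀ m n z, m ≠ n → π m (ι n z) = 0
  smul_mem : ∀ t ∈ T, ∀ n z, ∃ z', t • ι n z = ι (n + 1) z'

namespace IsComponentFamily

variable {T : Set S} {N : Type*} [AddCommGroup N] [Module S N] [Module R N]
  {L : ℕ → Type*} [∀ n, AddCommGroup (L n)] [∀ n, Module R (L n)]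
  {ι : ∀ n, L n →ₗ[R] N} {π : ∀ n, N →ₗ[R] L n}

omit [Algebra R S] in
theorem injective (h : IsComponentFamily T N L ι π) (n : ℕ) : Function.Injective (ι n) :=
  Function.LeftInverse.injective (h.proj_self n)

variable [IsScalarTower R S N]

/-- The components are finite over `R`: `L n` embeds into the quotient of the `S`-module generated
by `L n` by the one generated by `L (n + 1)`, and `T` annihilates this quotient. -/
theorem finite [IsNoetherianRing R] [IsNoetherianRing S] [Module.Finite S N]
    (h : IsComponentFamily T N L ι π) (hT : Algebra.adjoin R T = ⊤) (n : ℕ) :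
    Module.Finite R (L n) := by
  let G' : Submodule S N := Submodule.span S (Set.range (ι (n + 1)))
  let V : Submodule R N := ⨆ m, ⨆ _ : n < m, LinearMap.range (ι m)
  have hV : V ≤ LinearMap.ker (π n) := by
    refine iSup₂_le fun m hm => ?_
    rintro _ ⟨z, rfl⟩
    exact h.proj_of_ne n m z hm.ne
  have hTV : ∀ t ∈ T, ∀ w ∈ V, t • w ∈ V := by
    intro t ht w hw
    suffices V ≤ V.comap (Algebra.lsmul R R N t) from this hw
    refine iSup₂_le fun m hm => ?_
    rintro _ ⟨z, rfl⟩
    obtain ⟨z', hz'⟩ := h.smul_mem t ht m z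
    change t • ι m z ∈ V
    rw [hz']
    exact Submodule.mem_iSup_of_mem (m + 1) (Submodule.mem_iSup_of_mem (by lia) ⟨z', rfl⟩)
  have hG' : ∀ w ∈ G', π n w = 0 := by
    intro w hw
    refine hV ?_
    induction hw using Submodule.span_induction with
    | mem x hx =>
      exact Submodule.mem_iSup_of_mem (n + 1) (Submodule.mem_iSup_of_mem (by lia) hx)
    | zero => exact zero_mem _
    | add x y _ _ hx hy => exact add_mem hx hy
    | smul s x _ hx => exact smul_mem_of_adjoin_eq_top hT hTV s hx
  let H : Submodule S (N ⧸ G') := Submodule.span S (Set.range fun z => G'.mkQ (ι n z))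
  have hH : ∀ t ∈ T, ∀ w : H, t • w = 0 := by
    rintro t ht ⟨w, hw⟩
    refine Subtype.ext ?_
    change t • w = 0
    induction hw using Submodule.span_induction with
    | mem x hx =>
      obtain ⟨z, rfl⟩ := hx
      obtain ⟨z', hz'⟩ := h.smul_mem t ht n z
      dsimp only
      rw [← map_smul, hz', Submodule.mkQ_apply, Submodule.Quotient.mk_eq_zero]
      exact Submodule.subset_span ⟨z', rfl⟩
    | zero => exact smul_zero _
    | add x y _ _ hx hy => rw [smul_add, hx, hy, add_zero]
    | smul s x _ hx => rw [smul_comm, hx, smul_zero]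
  have : Module.Finite R H := finite_of_smul_eq_zero hT hH
  let f : L n →ₗ[R] H := LinearMap.codRestrict (H.restrictScalars R)
    ((G'.mkQ.restrictScalars R) ∘ₗ ι n) fun z => Submodule.subset_span ⟨z, rfl⟩
  refine Module.Finite.of_injective f ?_
  rw [← LinearMap.ker_eq_bot, LinearMap.ker_eq_bot']
  intro z hz
  have hz' : G'.mkQ (ι n z) = 0 := congrArg Subtype.val hz
  rw [Submodule.mkQ_apply, Submodule.Quotient.mk_eq_zero] at hz'
  rw [← h.proj_self n z, hG' _ hz']

/-- In large degrees no nonzero element is annihilated by all of `T`: the elements annihilated by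
`T` form a finite `R`-module, which meets only finitely many components. -/
theorem eventually_eq_zero [IsNoetherianRing R] [IsNoetherianRing S] [Module.Finite S N]
    (h : IsComponentFamily T N L ι π) (hT : Algebra.adjoin R T = ⊤) :
    ∀ᶠ n in Filter.atTop, ∀ z : L n, (∀ t ∈ T, t • ι n z = 0) → z = 0 := by
  let Z : Submodule S N :=
    { carrier := {w | ∀ t ∈ T, t • w = 0}
      add_mem' := fun ha hb t ht => by rw [smul_add, ha t ht, hb t ht, add_zero]
      zero_mem' := fun t _ => smul_zero t
      smul_mem' := fun s w hw t ht => by rw [smul_comm, hw t ht, smul_zero] }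
  have : Module.Finite R Z := finite_of_smul_eq_zero hT fun t ht w => Subtype.ext (w.2 t ht)
  have : IsNoetherian R Z := isNoetherian_of_isNoetherianRing_of_finite R Z
  let j : Z →ₗ[R] N := Z.subtype.restrictScalars R
  have hind : iSupIndep fun n => (LinearMap.range (ι n)).comap j := by
    intro n
    rw [Submodule.disjoint_def]
    rintro w ⟨z, hz⟩ hw
    have hle : (⨆ m, ⨆ _ : m ≠ n, (LinearMap.range (ι m)).comap j) ≤
        LinearMap.ker (π n ∘ₗ j) := by
      refine iSup₂_le fun m hm => ?_
      rintro v ⟨y, hy⟩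
      rw [LinearMap.mem_ker, LinearMap.comp_apply, ← hy, h.proj_of_ne n m y hm.symm]
    have h0 : π n (j w) = 0 := hle hw
    rw [← hz, h.proj_self] at h0
    refine Subtype.ext ?_
    change j w = 0
    rw [← hz, h0, map_zero]
  have hfin := WellFoundedGT.finite_ne_bot_of_iSupIndep hind
  rw [← Nat.cofinite_eq_atTop]
  filter_upwards [hfin.compl_mem_cofinite] with n hn z hz
  have hn : (LinearMap.range (ι n)).comap j = ⊥ := by simpa using hn
  have : (⟨ι n z, hz⟩ : Z) ∈ (LinearMap.range (ι n)).comap j := ⟨z, rfl⟩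
  rw [hn, Submodule.mem_bot] at this
  exact h.injective n ((congrArg Subtype.val this).trans (map_zero _).symm)

/-- The associated primes of the components are eventually constant. In large degrees they
increase: if `p` is the annihilator of `z`, then some `t ∈ T` has `t z` nonzero at `p`, and the
annihilator of a multiple of `t z` is `p`. They all lie in the finite set `Ass N`. -/
theorem exists_associatedPrimes_eq [IsNoetherianRing R] [IsNoetherianRing S] [Module.Finite S N]
    (h : IsComponentFamily T N L ι π) (hT : Algebra.adjoin R T = ⊤) :
    ∃ A : Set (Ideal R), ∀ᶠ n in Filter.atTop, associatedPrimes R (L n) = A := by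
  obtain ⟨n₀, hn₀⟩ := Filter.eventually_atTop.1 (h.eventually_eq_zero hT)
  have hstep : ∀ n ≥ n₀, associatedPrimes R (L n) ⊆ associatedPrimes R (L (n + 1)) := by
    intro n hn p hp
    have hpp := hp.1
    obtain ⟨-, z, hz⟩ := isAssociatedPrime_iff.1 hp
    have hzp : ∀ r, r ∈ p ↔ r • z = 0 := by
      intro r
      rw [hz, Submodule.mem_colon_singleton, Submodule.mem_bot]
    -- The elements `z'` with `ι z' ∈ T ι z`; they generate a finite `R`-module.
    let E : Submodule R (L (n + 1)) :=
      Submodule.span R {z' | ∃ t ∈ T, t • ι n z = ι (n + 1) z'}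
    have := h.finite hT (n + 1)
    obtain ⟨G, hG⟩ := IsNoetherian.noetherian E
    have hpE : ∀ r ∈ p, ∀ y ∈ E, r • y = 0 := by
      intro r hr y hy
      induction hy using Submodule.span_induction with
      | mem y hy =>
        obtain ⟨t, ht, hy⟩ := hy
        refine h.injective _ ?_
        rw [map_smul, ← hy, smul_comm, ← map_smul, (hzp r).1 hr, map_zero, smul_zero, map_zero]
      | zero => exact smul_zero r
      | add x y _ _ hx hy => rw [smul_add, hx, hy, add_zero]
      | smul s x _ hx => rw [smul_comm, hx, smul_zero]
    suffices ∃ y ∈ E, ∀ r ∉ p, r • y ≠ 0 by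
      obtain ⟨y, hyE, hy⟩ := this
      refine AssociatedPrimes.mem_iff.2 (isAssociatedPrime_iff.2 ⟨hpp, y, ?_⟩)
      ext r
      rw [Submodule.mem_colon_singleton, Submodule.mem_bot]
      exact ⟨fun hr => hpE r hr y hyE, fun hr => by_contra fun hrp => hy r hrp hr⟩
    by_contra! hc
    choose! f hf hfy using hc
    have hprod : ∏ g ∈ G, f g ∉ p := by
      intro hmem
      obtain ⟨g, hg, hgp⟩ := hpp.prod_mem_iff.1 hmem
      exact hf g (hG ▸ Submodule.subset_span hg) hgp
    have hkill : ∀ y ∈ E, (∏ g ∈ G, f g) • y = 0 := by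
      intro y hy
      rw [← hG] at hy
      induction hy using Submodule.span_induction with
      | mem g hg =>
        obtain ⟨c, hc⟩ := Finset.dvd_prod_of_mem f hg
        rw [hc, mul_comm, mul_smul, hfy g (hG ▸ Submodule.subset_span hg), smul_zero]
      | zero => exact smul_zero _
      | add x y _ _ hx hy => rw [smul_add, hx, hy, add_zero]
      | smul s x _ hx => rw [smul_comm, hx, smul_zero]
    refine hprod ((hzp _).2 (hn₀ n hn _ fun t ht => ?_))
    obtain ⟨z', hz'⟩ := h.smul_mem t ht n z
    rw [map_smul, smul_comm, hz', ← map_smul, hkill z' (Submodule.subset_span ⟨t, ht, hz'⟩),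
      map_zero]
  have hsub : ∀ n, associatedPrimes R (L n) ⊆ associatedPrimes R N := fun n =>
    associatedPrimes.subset_of_injective (h.injective n)
  have hfin := associatedPrimes_finite_of_finite_algebra (R := R) (S := S) N
  have hmono : Monotone fun i => associatedPrimes R (L (n₀ + i)) :=
    monotone_nat_of_le_succ fun i => hstep (n₀ + i) (by lia)
  -- A monotone sequence of subsets of a finite set is eventually equal to its union.
  refine ⟨⋃ i, associatedPrimes R (L (n₀ + i)), ?_⟩
  have hU : (⋃ i, associatedPrimes R (L (n₀ + i))).Finite :=
    hfin.subset (Set.iUnion_subset fun i => hsub _)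
  have hev : ∀ᶠ i in Filter.atTop, ∀ p ∈ ⋃ i, associatedPrimes R (L (n₀ + i)),
      p ∈ associatedPrimes R (L (n₀ + i)) := by
    rw [Filter.eventually_all_finite hU]
    intro p hp
    obtain ⟨i, hi⟩ := Set.mem_iUnion.1 hp
    exact Filter.eventually_atTop.2 ⟨i, fun j hij => hmono hij hi⟩
  obtain ⟨i₀, hi₀⟩ := Filter.eventually_atTop.1 hev
  refine Filter.eventually_atTop.2 ⟨n₀ + i₀, fun n hn => ?_⟩
  obtain ⟨i, rfl⟩ := Nat.exists_eq_add_of_le (show n₀ ≤ n by lia)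
  exact Set.Subset.antisymm (Set.subset_iUnion (fun i => associatedPrimes R (L (n₀ + i))) i)
    (hi₀ i (by lia))

/-- Component families pass to quotients by an ideal `K` of `R`. -/
theorem quotient (h : IsComponentFamily T N L ι π) (K : Ideal R) :
    ∃ (ι' : ∀ n, (L n ⧸ (K • ⊤ : Submodule R (L n))) →ₗ[R]
        N ⧸ (K.map (algebraMap R S) • ⊤ : Submodule S N))
      (π' : ∀ n, (N ⧸ (K.map (algebraMap R S) • ⊤ : Submodule S N)) →ₗ[R]
        L n ⧸ (K • ⊤ : Submodule R (L n))),
      IsComponentFamily T (N ⧸ (K.map (algebraMap R S) • ⊤ : Submodule S N))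
        (fun n => L n ⧸ (K • ⊤ : Submodule R (L n))) ι' π' := by
  set KN : Submodule S N := K.map (algebraMap R S) • ⊤ with hKN
  have hres : KN.restrictScalars R = K • (⊤ : Submodule R N) :=
    Ideal.smul_restrictScalars K ⊤
  have hι : ∀ n, (K • ⊤ : Submodule R (L n)) ≤ (KN.restrictScalars R).comap (ι n) := by
    intro n
    rw [hres, ← Submodule.map_le_iff_le_comap, Submodule.map_smul'']
    exact smul_mono_right _ le_top
  have hπ : ∀ n, KN.restrictScalars R ≤ (K • ⊤ : Submodule R (L n)).comap (π n) := by
    intro n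
    rw [hres, ← Submodule.map_le_iff_le_comap, Submodule.map_smul'']
    exact smul_mono_right _ le_top
  let e := Submodule.Quotient.restrictScalarsEquiv R KN
  refine ⟨fun n => e.toLinearMap ∘ₗ Submodule.mapQ _ _ (ι n) (hι n),
    fun n => Submodule.mapQ _ _ (π n) (hπ n) ∘ₗ e.symm.toLinearMap, ?_, ?_, ?_⟩
  · intro n z
    obtain ⟨z, rfl⟩ := Submodule.mkQ_surjective _ z
    simp [h.proj_self]
  · intro m n z hmn
    obtain ⟨z, rfl⟩ := Submodule.mkQ_surjective _ z
    simp [h.proj_of_ne m n z hmn]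
  · intro t ht n z
    obtain ⟨z, rfl⟩ := Submodule.mkQ_surjective _ z
    obtain ⟨z', hz'⟩ := h.smul_mem t ht n z
    refine ⟨Submodule.mkQ _ z', ?_⟩
    simp [e, ← Submodule.Quotient.mk_smul, hz']

theorem hasStableAss [IsNoetherianRing R] [IsNoetherianRing S] [Module.Finite S N]
    (h : IsComponentFamily T N L ι π) (hT : Algebra.adjoin R T = ⊤) :
    HasStableAss (R := R) L := by
  intro K
  obtain ⟨ι', π', h'⟩ := h.quotient K
  exact h'.exists_associatedPrimes_eq hT

end IsComponentFamily

end Graded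

/-! ### Powers of an ideal -/

section Powers

variable {R : Type*} [CommRing R]

/-- `(L/W) / K(L/W) ≃ L / (W + KL)`. -/
noncomputable def quotientSMulTopEquiv {L : Type*} [AddCommGroup L] [Module R L]
    (W : Submodule R L) (K : Ideal R) :
    ((L ⧸ W) ⧸ (K • ⊤ : Submodule R (L ⧸ W))) ≃ₗ[R] L ⧸ W ⊔ K • ⊤ :=
  (Submodule.quotEquivOfEq _ _ (by
    rw [Submodule.map_smul'', Submodule.map_top, Submodule.range_mkQ])).trans
    (Submodule.quotientQuotientEquivQuotientSup W (K • ⊤))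

theorem HasStableAss.quotient {L : ℕ → Type*} [∀ n, AddCommGroup (L n)] [∀ n, Module R (L n)]
    (hL : HasStableAss (R := R) L) (J : Ideal R) (W : ∀ n, Submodule R (L n))
    (hW : ∀ n, W n = J • ⊤) : HasStableAss (R := R) fun n => L n ⧸ W n := by
  intro K
  obtain ⟨A, hA⟩ := hL (J ⊔ K)
  refine ⟨A, hA.mono fun n hn => ?_⟩
  rw [← hn]
  refine LinearEquiv.AssociatedPrimes.eq ((quotientSMulTopEquiv (W n) K).trans
    (Submodule.quotEquivOfEq _ _ ?_))
  rw [hW, Submodule.sup_smul]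

theorem reesAlgebra_adjoin_eq_top (J : Ideal R) :
    Algebra.adjoin R {x : reesAlgebra J | ∃ a ∈ J, (x : Polynomial R) = Polynomial.monomial 1 a} =
      ⊤ := by
  refine Subalgebra.map_injective (f := (reesAlgebra J).val) Subtype.val_injective ?_
  rw [AlgHom.map_adjoin, Algebra.map_top, Subalgebra.range_val]
  refine Eq.trans ?_ (adjoin_monomial_eq_reesAlgebra J)
  congr 1
  ext f
  constructor
  · rintro ⟨x, ⟨a, ha, hx⟩, rfl⟩
    exact ⟨a, ha, hx.symm⟩
  · rintro ⟨a, ha, rfl⟩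
    exact ⟨⟨_, reesAlgebra.monomial_mem.2 (by simpa using ha)⟩, ⟨a, ha, rfl⟩, rfl⟩

variable {M : Type*} [AddCommGroup M] [Module R M]

/-- The powers `J ^ n M` are the components of the Rees module `⨁ J ^ n M`. -/
theorem hasStableAss_pow_smul [IsNoetherianRing R] [Module.Finite R M] (J : Ideal R) :
    HasStableAss (R := R) fun n => (J ^ n • ⊤ : Submodule R M) := by
  let F := J.stableFiltration (⊤ : Submodule R M)
  have : Module.Finite (reesAlgebra J) F.submodule := Module.Finite.iff_fg.2 <|
    (F.submodule_fg_iff_stable fun i => IsNoetherian.noetherian _).2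
      (J.stableFiltration_stable ⊤)
  let ι : ∀ n, (J ^ n • ⊤ : Submodule R M) →ₗ[R] F.submodule := fun n =>
    LinearMap.codRestrict (F.submodule.restrictScalars R)
      (PolynomialModule.lsingle R n ∘ₗ Submodule.subtype _) fun z i => by
        rw [LinearMap.comp_apply, PolynomialModule.lsingle_apply]
        split_ifs with h
        · subst h
          exact z.2
        · exact zero_mem _
  let π : ∀ n, F.submodule →ₗ[R] (J ^ n • ⊤ : Submodule R M) := fun n =>
    { toFun := fun f => ⟨f.1.coeff n, f.2 n⟩
      map_add' := fun _ _ => rfl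
      map_smul' := fun _ _ => rfl }
  have hιcoe : ∀ n z, (ι n z : PolynomialModule R M) = PolynomialModule.single R n (z : M) :=
    fun _ _ => rfl
  have h : IsComponentFamily
      {x : reesAlgebra J | ∃ a ∈ J, (x : Polynomial R) = Polynomial.monomial 1 a}
      F.submodule (fun n => (J ^ n • ⊤ : Submodule R M)) ι π := by
    refine ⟨fun n z => Subtype.ext ?_, fun m n z hmn => Subtype.ext ?_, ?_⟩
    · change (ι n z : PolynomialModule R M).coeff n = z
      simp [hιcoe]
    · change (ι n z : PolynomialModule R M).coeff m = 0
      simp [hιcoe, hmn.symm]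
    · rintro t ⟨a, ha, ht⟩ n z
      refine ⟨⟨a • z.1, ?_⟩, Subtype.ext ?_⟩
      · rw [pow_succ', Submodule.mul_smul]
        exact Submodule.smul_mem_smul ha z.2
      · rw [hιcoe]
        change (t : Polynomial R) • (ι n z : PolynomialModule R M) = _
        rw [hιcoe, ht, PolynomialModule.monomial_smul_single, add_comm]
  exact h.hasStableAss (reesAlgebra_adjoin_eq_top J)

theorem submoduleOf_pow_succ_smul_top (J : Ideal R) (n : ℕ) :
    (J ^ (n + 1) • ⊤ : Submodule R M).submoduleOf (J ^ n • ⊤ : Submodule R M) = J • ⊤ := by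
  refine Submodule.map_injective_of_injective (Submodule.subtype_injective _) ?_
  rw [Submodule.submoduleOf, Submodule.map_comap_subtype, Submodule.map_smul'', Submodule.map_top,
    Submodule.range_subtype, pow_succ', Submodule.mul_smul]
  exact inf_eq_right.2 Submodule.smul_le_right

theorem hasStableAss_pow_smul_quotient [IsNoetherianRing R] [Module.Finite R M] (J : Ideal R) :
    HasStableAss (R := R) fun n => (J ^ n • ⊤ : Submodule R M) ⧸
      (J ^ (n + 1) • ⊤ : Submodule R M).submoduleOf (J ^ n • ⊤ : Submodule R M) :=
  (hasStableAss_pow_smul J).quotient J _ fun n => submoduleOf_pow_succ_smul_top J n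

/-- Brodmann: `Ass (M / J ^ n M)` is eventually constant. Once `Ass (J ^ n M / J ^ (n + 1) M)` is
constant, the sequence `0 → J ^ n M / J ^ (n + 1) M → M / J ^ (n + 1) M → M / J ^ n M → 0` shows
that the finite sets `Ass (M / J ^ n M)` decrease. -/
theorem exists_associatedPrimes_quotient_pow_smul_eq [IsNoetherianRing R] [Module.Finite R M]
    (J : Ideal R) : ∃ A : Set (Ideal R), ∀ᶠ n in Filter.atTop,
      associatedPrimes R (M ⧸ (J ^ n • ⊤ : Submodule R M)) = A := by
  obtain ⟨B, hB⟩ : ∃ B : Set (Ideal R), ∀ᶠ n in Filter.atTop, associatedPrimes R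
      ((J ^ n • ⊤ : Submodule R M) ⧸
        (J ^ (n + 1) • ⊤ : Submodule R M).submoduleOf (J ^ n • ⊤ : Submodule R M)) = B := by
    obtain ⟨B, hB⟩ := hasStableAss_pow_smul (M := M) J J
    refine ⟨B, hB.mono fun n hn => ?_⟩
    rw [submoduleOf_pow_succ_smul_top, hn]
  obtain ⟨n₀, hn₀⟩ := Filter.eventually_atTop.1 hB
  have hle : ∀ n, (J ^ (n + 1) • ⊤ : Submodule R M) ≤ J ^ n • ⊤ := fun n =>
    Submodule.smul_mono_left (Ideal.pow_le_pow_right n.le_succ)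
  have hinj : ∀ n, Function.Injective (Submodule.mapQ
      ((J ^ (n + 1) • ⊤ : Submodule R M).submoduleOf (J ^ n • ⊤ : Submodule R M))
      (J ^ (n + 1) • ⊤ : Submodule R M) (Submodule.subtype _) le_rfl) := fun n =>
    LinearMap.ker_eq_bot.1 (Submodule.ker_liftQ_eq_bot _ _ _
      (by simp [LinearMap.ker_comp, Submodule.submoduleOf]))
  have hexact : ∀ n, Function.Exact (Submodule.mapQ
      ((J ^ (n + 1) • ⊤ : Submodule R M).submoduleOf (J ^ n • ⊤ : Submodule R M))
      (J ^ (n + 1) • ⊤ : Submodule R M) (Submodule.subtype _) le_rfl)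
      (Submodule.factor (hle n)) := by
    intro n x
    obtain ⟨x, rfl⟩ := Submodule.mkQ_surjective _ x
    constructor
    · intro hx
      have hx' : x ∈ (J ^ n • ⊤ : Submodule R M) := by simpa using hx
      exact ⟨Submodule.mkQ _ ⟨x, hx'⟩, rfl⟩
    · rintro ⟨y, hy⟩
      obtain ⟨y, rfl⟩ := Submodule.mkQ_surjective _ y
      rw [← hy]
      exact (Submodule.Quotient.mk_eq_zero _).2 y.2
  have hstep : ∀ n ≥ n₀, associatedPrimes R (M ⧸ (J ^ (n + 1 + 1) • ⊤ : Submodule R M)) ⊆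
      associatedPrimes R (M ⧸ (J ^ (n + 1) • ⊤ : Submodule R M)) := by
    intro n hn
    refine (associatedPrimes.subset_union_of_exact (hinj (n + 1)) (hexact (n + 1))).trans
      (Set.union_subset ?_ subset_rfl)
    rw [hn₀ (n + 1) (by lia), ← hn₀ n hn]
    exact associatedPrimes.subset_of_injective (hinj n)
  have hanti : Antitone fun i =>
      associatedPrimes R (M ⧸ (J ^ (n₀ + 1 + i) • ⊤ : Submodule R M)) :=
    antitone_nat_of_succ_le fun i => by
      rw [show n₀ + 1 + (i + 1) = n₀ + i + 1 + 1 by lia, show n₀ + 1 + i = n₀ + i + 1 by lia]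
      exact hstep (n₀ + i) (by lia)
  -- A decreasing sequence of finite sets is eventually equal to its intersection.
  refine ⟨⋂ i, associatedPrimes R (M ⧸ (J ^ (n₀ + 1 + i) • ⊤ : Submodule R M)), ?_⟩
  have hev : ∀ᶠ i in Filter.atTop,
      ∀ p ∈ associatedPrimes R (M ⧸ (J ^ (n₀ + 1) • ⊤ : Submodule R M)),
      p ∈ associatedPrimes R (M ⧸ (J ^ (n₀ + 1 + i) • ⊤ : Submodule R M)) →
      p ∈ ⋂ i, associatedPrimes R (M ⧸ (J ^ (n₀ + 1 + i) • ⊤ : Submodule R M)) := by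
    rw [Filter.eventually_all_finite (associatedPrimes.finite R _)]
    intro p _
    by_cases hp : p ∈ ⋂ i, associatedPrimes R (M ⧸ (J ^ (n₀ + 1 + i) • ⊤ : Submodule R M))
    · exact Filter.Eventually.of_forall fun _ _ => hp
    · obtain ⟨i, hi⟩ := not_forall.1 (mt Set.mem_iInter.2 hp)
      exact Filter.eventually_atTop.2 ⟨i, fun j hij hj => absurd (hanti hij hj) hi⟩
  obtain ⟨i₀, hi₀⟩ := Filter.eventually_atTop.1 hev
  refine Filter.eventually_atTop.2 ⟨n₀ + 1 + i₀, fun n hn => ?_⟩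
  obtain ⟨i, rfl⟩ := Nat.exists_eq_add_of_le (show n₀ + 1 ≤ n by lia)
  refine Set.Subset.antisymm (fun p hp => hi₀ i (by lia) p ?_ hp) (Set.iInter_subset _ i)
  exact hanti (Nat.zero_le i) hp

theorem hasStableAss_quotient_pow_smul [IsNoetherianRing R] [Module.Finite R M] (J : Ideal R) :
    HasStableAss (R := R) fun n => M ⧸ (J ^ n • ⊤ : Submodule R M) := by
  intro K
  obtain ⟨A, hA⟩ := exists_associatedPrimes_quotient_pow_smul_eq
    (M := M ⧸ (K • ⊤ : Submodule R M)) J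
  refine ⟨A, hA.mono fun n hn => ?_⟩
  rw [← hn]
  exact LinearEquiv.AssociatedPrimes.eq ((quotientSMulTopEquiv _ K).trans
    ((Submodule.quotEquivOfEq _ _ (sup_comm _ _)).trans (quotientSMulTopEquiv _ (J ^ n)).symm))

end Powers

/-! ### Asymptotic stability of the depth in dimension `> k` -/

theorem theorem1p1 {R : Type*} [CommRing R] [IsLocalRing R] [IsNoetherianRing R]
    (k : ℤ) (hk : -1 ≤ k) (I J : Ideal R)
    (M : Type*) [AddCommGroup M] [Module R M] [Module.Finite R M] :
    -- the modules `J^n M / J^(n+1) M`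
    (∃ r : ℕ∞, ∀ᶠ n : ℕ in Filter.atTop,
      IsDepthInDim k I
        ((J ^ n • ⊤ : Submodule R M) ⧸
          (J ^ (n + 1) • ⊤ : Submodule R M).submoduleOf (J ^ n • ⊤ : Submodule R M)) r) ∧
    -- the modules `M / J^n M`
    (∃ s : ℕ∞, ∀ᶠ n : ℕ in Filter.atTop,
      IsDepthInDim k I (M ⧸ (J ^ n • ⊤ : Submodule R M)) s) ∧
    -- the components of a finitely generated graded module over a standard graded `R`-algebra
    (∀ (S : Type*) [CommRing S] [Algebra R S] (𝒜 : ℕ → Submodule R S) [GradedAlgebra 𝒜]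
      (N : Type*) [AddCommGroup N] [Module S N] [Module R N] [IsScalarTower R S N]
      (ℳ : ℕ → Submodule R N) [DirectSum.Decomposition ℳ] [SetLike.GradedSMul 𝒜 ℳ],
      Algebra.adjoin R (𝒜 1 : Set S) = ⊤ → Algebra.FiniteType R S → Module.Finite S N →
      ∃ t : ℕ∞, ∀ᶠ n : ℕ in Filter.atTop, IsDepthInDim k I (ℳ n) t) := by
  refine ⟨?_, ?_, ?_⟩
  · exact (hasStableAss_pow_smul_quotient J).exists_eventually_isDepthInDim k I
  · exact (hasStableAss_quotient_pow_smul J).exists_eventually_isDepthInDim k I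
  · intro S _ _ 𝒜 _ N _ _ _ _ ℳ _ _ hT _ _
    have : IsNoetherianRing S := Algebra.FiniteType.isNoetherianRing R S
    have h : IsComponentFamily (𝒜 1 : Set S) N (fun n => ℳ n) (fun n => (ℳ n).subtype)
        (fun n => DirectSum.component R ℕ (fun n => ℳ n) n ∘ₗ
          (DirectSum.decomposeLinearEquiv ℳ).toLinearMap) := by
      refine ⟨fun n z => ?_, fun m n z hmn => ?_, fun t ht n z => ?_⟩
      · simp
      · simp [DirectSum.component.of, hmn.symm]
      · refine ⟨⟨t • z.1, ?_⟩, rfl⟩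
        have := SetLike.GradedSMul.smul_mem (A := 𝒜) (B := ℳ) ht z.2
        rwa [vadd_eq_add, add_comm] at this
    have := fun n => h.finite hT n
    exact (h.hasStableAss hT).exists_eventually_isDepthInDim k I
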